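/- For an $n\times n$ complex matrix $A$ with singular values $\sigma_1\ge\sigma_2\ge\cdots\ge\sigma_n\ge 0$, let $\|A\|_p=\big(\sum_{j=1}^n\sigma_j^p\big)^{1/p}$ for real $p\in[1,\infty)$ and $\|A\|_\infty=\sigma_1$ be its Schatten $p$-norm. Let $\mathcal D_n$ be the set of $n\times n$ density matrices (complex positive semidefinite matrices of trace $1$), and for integers $1\le k\le n$ let $\mathcal D_{n,k}\subseteq\mathcal D_n$ be the set of density matrices of rank at most $k$. For $X\in\mathcal D_n$ put \[ d_p(X,\mathcal D_{n,k})=\min_{Y\in\mathcal D_{n,k}}\|X-Y\|_p . \] Let $p\in[1,\infty]$. Then the following are equivalent: (a) $d_p(X,\mathcal D_{n,k})\le d_p\big(\tfrac1n I_n,\mathcal D_{n,k}\big)$ for all integers $1\le k\le n$ and all $X\in\mathcal D_n$; (b) $p\in\{1\}\cup[2,4]$. -/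

import Mathlib

open scoped ComplexOrder ENNReal

noncomputable section

/-- The `j`-th largest singular value of a complex `n × n` matrix, counted from `j = 0`, with
multiplicity (and `0` for `n ≤ j`). -/
def singVal {n : ℕ} (A : Matrix (Fin n) (Fin n) ℂ) (j : ℕ) : ℝ :=
  (Matrix.toEuclideanLin A).singularValues j

/-- The Schatten `p`-norm: `(∑ σⱼ ^ p) ^ (1 / p)` for finite `p`, and the largest singular value
(the operator norm) for `p = ∞`. -/
def schattenNorm {n : ℕ} (p : ℝ≥0∞) (A : Matrix (Fin n) (Fin n) ℂ) : ℝ :=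
  if p = ∞ then singVal A 0
  else (∑ j : Fin n, singVal A j ^ p.toReal) ^ (1 / p.toReal)

/-- Density matrices: positive semidefinite (in particular Hermitian) complex matrices of trace
one. -/
def densityMatrices (n : ℕ) : Set (Matrix (Fin n) (Fin n) ℂ) :=
  {X | X.PosSemidef ∧ X.trace = 1}

/-- Density matrices of rank at most `k`. -/
def lowRankDensityMatrices (n k : ℕ) : Set (Matrix (Fin n) (Fin n) ℂ) :=
  {X | X ∈ densityMatrices n ∧ X.rank ≤ k}

/-- The maximally mixed state `I / n`. -/
def maximallyMixed (n : ℕ) : Matrix (Fin n) (Fin n) ℂ :=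
  ((n : ℂ)⁻¹) • (1 : Matrix (Fin n) (Fin n) ℂ)

/-- The distance, in the Schatten `p`-norm, from `X` to a set `S` of matrices, as the infimum of
`‖X - Y‖ₚ` over `Y ∈ S`; it is a minimum when `S` is non-empty and compact and `1 ≤ p`. -/
def schattenDist {n : ℕ} (p : ℝ≥0∞) (X : Matrix (Fin n) (Fin n) ℂ)
    (S : Set (Matrix (Fin n) (Fin n) ℂ)) : ℝ :=
  sInf ((fun Y => schattenNorm p (X - Y)) '' S)

end

/-! ### Quadratic forms and eigenvalues -/

section Eigenbasis

variable {E ι κ : Type*} [NormedAddCommGroup E] [InnerProductSpace ℂ E]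
  [Fintype ι] [Fintype κ]

/-! For finite `p` everything reduces to the monotonicity of `f(x) = (x^p + x)/(1 + x)^p`
(`uniformProfile`).

Upper bound: keep the `k` largest eigenvalues of `X` and spread the lost mass `t` evenly over them.
Each lost eigenvalue is at most `(1 - t)/k`, so the `p`-th power of the error is at most `k^(1-p)
f(t/(1-t))`, where `t/(1-t) ≤ (n-k)/k` (`schattenDist_le_of_monotoneOn`).

Lower bound: for a spectrum uniform on `r` values, no `Y` of rank at most `k` does better than
`k^(1-p) f((r-k)/k)`, by testing `X - Y` on eigenvectors of `Y` and on vectors of its kernel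
(`le_sum_abs_eigenvalues_rpow`).

Hence (a) follows if `f` is increasing. Conversely, comparing uniform spectra of different lengths
shows that (a) forces `f` to increase on the positive rationals, hence on `(0, ∞)`. The sign of `f'`
is that of `p x^(p-1) + 1 - (p-1) x`, which is nonnegative on `(0, ∞)` exactly for `p = 1` or `2 ≤ p
≤ 4` (within `p ≥ 1`). The case `p = ∞` fails by an explicit example. -/

theorem re_inner_eq_sum_of_eigenbasis (T : E →ₗ[ℂ] E) (b : OrthonormalBasis ι ℂ E) (d : ι → ℝ)
    (h : ∀ i, T (b i) = (d i : ℂ) • b i) (u : E) :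
    (inner ℂ u (T u)).re = ∑ i, d i * ‖inner ℂ (b i) u‖ ^ 2 := by
  have hT : T u = ∑ i, (inner ℂ (b i) u * (d i : ℂ)) • b i := by
    conv_lhs => rw [← b.sum_repr' u]
    simp only [map_sum, map_smul, h, smul_smul]
  rw [hT, inner_sum, Complex.re_sum]
  refine Finset.sum_congr rfl fun i _ => ?_
  rw [inner_smul_right, mul_right_comm, mul_comm (inner ℂ (b i) u), ← inner_conj_symm u (b i),
    Complex.conj_mul', mul_comm]
  norm_cast

/-- Peierls-type inequality: each diagonal entry is an average of the `d i` with weights `‖⟨b i, u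
j⟩‖²`, so convexity of `|·|^p` applies; by Bessel, the weights of each `i` sum to at most one over
`j`. -/
theorem sum_abs_re_inner_rpow_le (T : E →ₗ[ℂ] E) (b : OrthonormalBasis ι ℂ E) (d : ι → ℝ)
    (h : ∀ i, T (b i) = (d i : ℂ) • b i) {u : κ → E} (hu : Orthonormal ℂ u) {p : ℝ} (hp : 1 ≤ p) :
    ∑ j, |(inner ℂ (u j) (T (u j))).re| ^ p ≤ ∑ i, |d i| ^ p := by
  calc ∑ j, |(inner ℂ (u j) (T (u j))).re| ^ p
      ≤ ∑ j, ∑ i, ‖inner ℂ (b i) (u j)‖ ^ 2 * |d i| ^ p := by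
        refine Finset.sum_le_sum fun j _ => ?_
        have hw : ∑ i, ‖inner ℂ (b i) (u j)‖ ^ 2 = 1 := by
          rw [b.sum_sq_norm_inner_right, hu.1 j, one_pow]
        refine le_trans (Real.rpow_le_rpow (abs_nonneg _) ?_ (by linarith))
          (Real.rpow_arith_mean_le_arith_mean_rpow Finset.univ _ (fun i => |d i|)
            (fun i _ => sq_nonneg _) hw (fun i _ => abs_nonneg _) hp)
        rw [re_inner_eq_sum_of_eigenbasis T b d h]
        refine (Finset.abs_sum_le_sum_abs _ _).trans (le_of_eq ?_)
        refine Finset.sum_congr rfl fun i _ => ?_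
        rw [abs_mul, abs_of_nonneg (sq_nonneg ‖_‖), mul_comm]
    _ = ∑ i, |d i| ^ p * ∑ j, ‖inner ℂ (u j) (b i)‖ ^ 2 := by
        rw [Finset.sum_comm]
        refine Finset.sum_congr rfl fun i _ => ?_
        rw [Finset.mul_sum]
        refine Finset.sum_congr rfl fun j _ => ?_
        rw [mul_comm, norm_inner_symm]
    _ ≤ ∑ i, |d i| ^ p := by
        refine Finset.sum_le_sum fun i _ => mul_le_of_le_one_right (by positivity) ?_
        refine (hu.sum_inner_products_le (b i)).trans ?_
        rw [b.norm_eq_one, one_pow]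

theorem abs_re_inner_le_of_eigenbasis (T : E →ₗ[ℂ] E) (b : OrthonormalBasis ι ℂ E) (d : ι → ℝ)
    (h : ∀ i, T (b i) = (d i : ℂ) • b i) {u : E} (hu : ‖u‖ = 1) {c : ℝ} (hc : ∀ i, |d i| ≤ c) :
    |(inner ℂ u (T u)).re| ≤ c := by
  rw [re_inner_eq_sum_of_eigenbasis T b d h]
  calc _ ≤ ∑ i, |d i * ‖inner ℂ (b i) u‖ ^ 2| := Finset.abs_sum_le_sum_abs _ _
    _ ≤ ∑ i, c * ‖inner ℂ (b i) u‖ ^ 2 := by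
        refine Finset.sum_le_sum fun i _ => ?_
        rw [abs_mul, abs_of_nonneg (sq_nonneg ‖_‖)]
        exact mul_le_mul_of_nonneg_right (hc i) (sq_nonneg _)
    _ = c := by rw [← Finset.mul_sum, b.sum_sq_norm_inner_right, hu, one_pow, mul_one]

end Eigenbasis

/-! ### Schatten norms of matrices with a real orthonormal eigenbasis -/

section SingularValues

variable {n : ℕ}

/-- The basis `b` diagonalises `T* T` with entries `(d i)²`, so comparing roots of its
characteristic polynomial and taking square roots suffices. Multisets avoid having to sort the `|d
i|`. -/
theorem map_singVal_eq_of_eigenbasis (A : Matrix (Fin n) (Fin n) ℂ)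
    (b : OrthonormalBasis (Fin n) ℂ (EuclideanSpace ℂ (Fin n))) (d : Fin n → ℝ)
    (h : ∀ i, Matrix.toEuclideanLin A (b i) = (d i : ℂ) • b i) :
    Multiset.map (fun j : Fin n => singVal A j) Finset.univ.val =
      Multiset.map (fun i => |d i|) Finset.univ.val := by
  set T := Matrix.toEuclideanLin A with hT
  have hadj : ∀ i, LinearMap.adjoint T (b i) = (d i : ℂ) • b i := by
    intro i
    refine InnerProductSpace.ext_inner_left_basis b.toBasis fun j => ?_
    rw [b.coe_toBasis, LinearMap.adjoint_inner_right, h, inner_smul_left, inner_smul_right,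
      b.inner_eq_ite]
    split_ifs with hij
    · simp [hij]
    · simp
  have hfin : Module.finrank ℂ (EuclideanSpace ℂ (Fin n)) = n := finrank_euclideanSpace_fin
  have hchar : (LinearMap.adjoint T ∘ₗ T).charpoly =
      ∏ i, (Polynomial.X - Polynomial.C (((d i) ^ 2 : ℝ) : ℂ)) := by
    have hM : LinearMap.toMatrix b.toBasis b.toBasis (LinearMap.adjoint T ∘ₗ T) =
        Matrix.diagonal fun i => (((d i) ^ 2 : ℝ) : ℂ) := by
      ext i j
      rw [LinearMap.toMatrix_apply]
      rw [OrthonormalBasis.coe_toBasis_repr_apply, b.repr_apply_apply, b.coe_toBasis,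
        LinearMap.comp_apply, h, map_smul, hadj, smul_smul, inner_smul_right, b.inner_eq_ite,
        Matrix.diagonal_apply]
      split_ifs with hij
      · simp [hij, sq]
      · simp
    rw [← LinearMap.charpoly_toMatrix _ b.toBasis, hM, Matrix.charpoly_diagonal]
  have hroots := T.isSymmetric_adjoint_comp_self.roots_charpoly_eq_eigenvalues hfin
  rw [hchar, Polynomial.roots_prod _ _
    (Finset.prod_ne_zero_iff.2 fun i _ => Polynomial.X_sub_C_ne_zero _)] at hroots
  simp only [Polynomial.roots_X_sub_C, Multiset.bind_singleton] at hroots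
  have := congrArg (Multiset.map fun z : ℂ => √z.re) hroots
  simp only [Multiset.map_map, Function.comp_def, Complex.ofReal_re, Real.sqrt_sq_eq_abs] at this
  rw [this]
  refine Multiset.map_congr rfl fun i _ => ?_
  rw [singVal, ← hT, T.singularValues_fin hfin i]
  simp

theorem schattenNorm_of_eigenbasis {p : ℝ≥0∞} (hp : p ≠ ∞) (A : Matrix (Fin n) (Fin n) ℂ)
    (b : OrthonormalBasis (Fin n) ℂ (EuclideanSpace ℂ (Fin n))) (d : Fin n → ℝ)
    (h : ∀ i, Matrix.toEuclideanLin A (b i) = (d i : ℂ) • b i) :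
    schattenNorm p A = (∑ i, |d i| ^ p.toReal) ^ (1 / p.toReal) := by
  rw [schattenNorm, if_neg hp]
  have := congrArg (fun s => (Multiset.map (fun x : ℝ => x ^ p.toReal) s).sum)
    (map_singVal_eq_of_eigenbasis A b d h)
  simp only [Multiset.map_map, Function.comp_def] at this
  exact congrArg (· ^ (1 / p.toReal)) this

theorem abs_le_schattenNorm_top (A : Matrix (Fin n) (Fin n) ℂ)
    (b : OrthonormalBasis (Fin n) ℂ (EuclideanSpace ℂ (Fin n))) (d : Fin n → ℝ)
    (h : ∀ i, Matrix.toEuclideanLin A (b i) = (d i : ℂ) • b i) (i : Fin n) :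
    |d i| ≤ schattenNorm ∞ A := by
  rw [schattenNorm, if_pos rfl]
  have hmem : |d i| ∈ Multiset.map (fun i => |d i|) Finset.univ.val :=
    Multiset.mem_map_of_mem _ (Finset.mem_univ i)
  rw [← map_singVal_eq_of_eigenbasis A b d h, Multiset.mem_map] at hmem
  obtain ⟨j, -, hj⟩ := hmem
  rw [← hj]
  exact (Matrix.toEuclideanLin A).singularValues_antitone (Nat.zero_le _)

theorem schattenNorm_top_le [NeZero n] (A : Matrix (Fin n) (Fin n) ℂ)
    (b : OrthonormalBasis (Fin n) ℂ (EuclideanSpace ℂ (Fin n))) (d : Fin n → ℝ)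
    (h : ∀ i, Matrix.toEuclideanLin A (b i) = (d i : ℂ) • b i) {c : ℝ} (hc : ∀ i, |d i| ≤ c) :
    schattenNorm ∞ A ≤ c := by
  rw [schattenNorm, if_pos rfl]
  have hmem : singVal A ((0 : Fin n) : ℕ) ∈
      Multiset.map (fun j : Fin n => singVal A j) Finset.univ.val :=
    Multiset.mem_map_of_mem (fun j : Fin n => singVal A j) (Finset.mem_univ_val 0)
  rw [map_singVal_eq_of_eigenbasis A b d h, Multiset.mem_map] at hmem
  obtain ⟨j, -, hj⟩ := hmem
  rw [Fin.val_zero] at hj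
  exact hj ▸ hc j

theorem schattenNorm_nonneg (p : ℝ≥0∞) (A : Matrix (Fin n) (Fin n) ℂ) : 0 ≤ schattenNorm p A := by
  have h : ∀ j, 0 ≤ singVal A j := fun j => LinearMap.singularValues_nonneg _ j
  unfold schattenNorm
  split_ifs
  · exact h 0
  · exact Real.rpow_nonneg (Finset.sum_nonneg fun j _ => Real.rpow_nonneg (h _) _) _

theorem schattenDist_le_schattenNorm (p : ℝ≥0∞) (X : Matrix (Fin n) (Fin n) ℂ)
    {S : Set (Matrix (Fin n) (Fin n) ℂ)} {Y : Matrix (Fin n) (Fin n) ℂ} (hY : Y ∈ S) :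
    schattenDist p X S ≤ schattenNorm p (X - Y) :=
  csInf_le ⟨0, by rintro _ ⟨Z, -, rfl⟩; exact schattenNorm_nonneg p _⟩ ⟨Y, hY, rfl⟩

end SingularValues

/-! ### Changing the spectrum in a fixed eigenbasis -/

section Spectral

variable {n : ℕ} {A : Matrix (Fin n) (Fin n) ℂ}

theorem Matrix.IsHermitian.toEuclideanLin_eigenvectorBasis (hA : A.IsHermitian) (i : Fin n) :
    Matrix.toEuclideanLin A (hA.eigenvectorBasis i) =
      (hA.eigenvalues i : ℂ) • hA.eigenvectorBasis i := by
  have := hA.mulVec_eigenvectorBasis i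
  ext j
  simpa using congrFun this j

/-- The matrix with eigenvalues `d` in the eigenvector basis of the Hermitian matrix `A`. -/
noncomputable def Matrix.IsHermitian.withEigenvalues (hA : A.IsHermitian) (d : Fin n → ℝ) :
    Matrix (Fin n) (Fin n) ℂ :=
  (hA.eigenvectorUnitary : Matrix (Fin n) (Fin n) ℂ) *
    Matrix.diagonal (fun i => (d i : ℂ)) * star (hA.eigenvectorUnitary : Matrix (Fin n) (Fin n) ℂ)

theorem Matrix.IsHermitian.toEuclideanLin_withEigenvalues (hA : A.IsHermitian) (d : Fin n → ℝ)
    (i : Fin n) :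
    Matrix.toEuclideanLin (hA.withEigenvalues d) (hA.eigenvectorBasis i) =
      (d i : ℂ) • hA.eigenvectorBasis i := by
  have : (hA.withEigenvalues d).mulVec ⇑(hA.eigenvectorBasis i) =
      (d i : ℂ) • ⇑(hA.eigenvectorBasis i) := by
    rw [withEigenvalues, ← Matrix.mulVec_mulVec, hA.star_eigenvectorUnitary_mulVec,
      ← Matrix.mulVec_mulVec, Matrix.diagonal_mulVec_single, mul_one,
      ← hA.eigenvectorUnitary_mulVec, ← Matrix.mulVec_smul]
    congr 1
    ext j
    simp [Pi.single_apply]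
  ext j
  simpa using congrFun this j

theorem Matrix.IsHermitian.trace_withEigenvalues (hA : A.IsHermitian) (d : Fin n → ℝ) :
    (hA.withEigenvalues d).trace = ((∑ i, d i : ℝ) : ℂ) := by
  rw [withEigenvalues, Matrix.trace_mul_comm, ← mul_assoc, Unitary.coe_star_mul_self, one_mul,
    Matrix.trace_diagonal, Complex.ofReal_sum]

theorem Matrix.IsHermitian.posSemidef_withEigenvalues (hA : A.IsHermitian) {d : Fin n → ℝ}
    (hd : ∀ i, 0 ≤ d i) : (hA.withEigenvalues d).PosSemidef := by
  rw [withEigenvalues, Matrix.star_eq_conjTranspose]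
  exact (Matrix.PosSemidef.diagonal fun i => by simpa using hd i).mul_mul_conjTranspose_same _

theorem Matrix.IsHermitian.rank_withEigenvalues_le (hA : A.IsHermitian) {d : Fin n → ℝ}
    {S : Finset (Fin n)} (hd : ∀ i ∉ S, d i = 0) : (hA.withEigenvalues d).rank ≤ S.card := by
  refine (Matrix.rank_mul_le_left _ _).trans ((Matrix.rank_mul_le_right _ _).trans ?_)
  rw [Matrix.rank_diagonal, Fintype.card_subtype]
  refine Finset.card_le_card fun i hi => ?_
  by_contra hS
  simp [hd i hS] at hi

end Spectral

/-! ### Monotonicity of the profile function -/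

section ProfileFunction

/-- Up to the factor `k ^ (1 - p)`, the `p`-th power of the Schatten distance from a uniform
spectrum of length `k + m` to the density matrices of rank at most `k`, with `x = m / k`. -/
noncomputable def uniformProfile (p x : ℝ) : ℝ := (x ^ p + x) / (1 + x) ^ p

/-- The factor of the derivative of `uniformProfile` that carries its sign. -/
noncomputable def profileSlope (p x : ℝ) : ℝ := p * x ^ (p - 1) + 1 - (p - 1) * x

theorem uniformProfile_nonneg (p : ℝ) {x : ℝ} (hx : 0 ≤ x) : 0 ≤ uniformProfile p x := by
  unfold uniformProfile; positivity

theorem hasDerivAt_uniformProfile (p : ℝ) {x : ℝ} (hx : 0 < x) :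
    HasDerivAt (uniformProfile p)
      ((1 + x) ^ (p - 1) * profileSlope p x / ((1 + x) ^ p) ^ 2) x := by
  have h1 : HasDerivAt (fun y : ℝ => y ^ p + y) (p * x ^ (p - 1) + 1) x :=
    (Real.hasDerivAt_rpow_const (Or.inl hx.ne')).add (hasDerivAt_id x)
  have h2 : HasDerivAt (fun y : ℝ => (1 + y) ^ p) (1 * p * (1 + x) ^ (p - 1)) x :=
    ((hasDerivAt_id x).const_add 1).rpow_const (Or.inl (by simp; positivity))
  have h3 := h1.div h2 (by positivity)
  refine h3.congr_deriv ?_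
  congr 1
  have e1 : (1 + x) ^ p = (1 + x) ^ (p - 1) * (1 + x) := by
    rw [← Real.rpow_add_one (by positivity), sub_add_cancel]
  have e2 : x ^ p = x ^ (p - 1) * x := by
    rw [← Real.rpow_add_one hx.ne', sub_add_cancel]
  rw [e1, e2, profileSlope]
  ring

theorem continuousOn_uniformProfile {p : ℝ} (hp : 1 ≤ p) :
    ContinuousOn (uniformProfile p) (Set.Ici 0) := by
  unfold uniformProfile
  refine ContinuousOn.div ?_ ?_ fun x hx => ?_
  · exact (continuousOn_id.rpow_const fun x _ => Or.inr (by linarith)).add continuousOn_id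
  · exact (continuousOn_const.add continuousOn_id).rpow_const fun x _ => Or.inr (by linarith)
  · have : (0 : ℝ) ≤ x := hx
    positivity

theorem monotoneOn_uniformProfile {p : ℝ} (hp : 1 ≤ p) (h : ∀ x, 0 < x → 0 ≤ profileSlope p x) :
    MonotoneOn (uniformProfile p) (Set.Ici 0) := by
  refine monotoneOn_of_deriv_nonneg (convex_Ici 0) (continuousOn_uniformProfile hp) ?_ ?_
  · rw [interior_Ici]
    exact fun x hx => (hasDerivAt_uniformProfile p hx).differentiableAt.differentiableWithinAt
  · rw [interior_Ici]
    intro x hx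
    have hx : 0 < x := hx
    rw [(hasDerivAt_uniformProfile p hx).deriv]
    have := h x hx
    positivity

theorem profileSlope_nonneg_of_monotoneOn {p : ℝ}
    (h : MonotoneOn (uniformProfile p) (Set.Ioi 0)) {x : ℝ} (hx : 0 < x) :
    0 ≤ profileSlope p x := by
  have hd : 0 ≤ (1 + x) ^ (p - 1) * profileSlope p x / ((1 + x) ^ p) ^ 2 := by
    rw [← (hasDerivAt_uniformProfile p hx).deriv,
      ← derivWithin_of_isOpen isOpen_Ioi (Set.mem_Ioi.2 hx)]
    exact h.derivWithin_nonneg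
  by_contra! hneg
  have : (1 + x) ^ (p - 1) * profileSlope p x / ((1 + x) ^ p) ^ 2 < 0 :=
    div_neg_of_neg_of_pos (mul_neg_of_pos_of_neg (by positivity) hneg) (by positivity)
  linarith

/-- Approximating `x` from below and `y` from above keeps the rationals in order, even when `x = y`.
-/
theorem monotoneOn_of_rat {f : ℝ → ℝ} (hf : ContinuousOn f (Set.Ioi 0))
    (h : ∀ q r : ℚ, 0 < q → q ≤ r → f q ≤ f r) : MonotoneOn f (Set.Ioi 0) := by
  intro x hx y hy hxy
  have hseqx : ∃ u : ℕ → ℚ, (∀ n, (u n : ℝ) < x) ∧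
      Filter.Tendsto (fun n => (u n : ℝ)) Filter.atTop (nhds x) := by
    obtain ⟨u, -, hu, hlim⟩ := Rat.denseRange_cast.exists_seq_strictMono_tendsto Rat.cast_mono x
    exact ⟨u, hu, hlim⟩
  have hseqy : ∃ u : ℕ → ℚ, (∀ n, y < (u n : ℝ)) ∧
      Filter.Tendsto (fun n => (u n : ℝ)) Filter.atTop (nhds y) := by
    obtain ⟨u, -, hu, hlim⟩ := Rat.denseRange_cast.exists_seq_strictAnti_tendsto Rat.cast_mono y
    exact ⟨u, hu, hlim⟩
  obtain ⟨u, hu, hux⟩ := hseqx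
  obtain ⟨v, hv, hvy⟩ := hseqy
  have hfx := (hf.continuousAt (isOpen_Ioi.mem_nhds hx)).tendsto.comp hux
  have hfy := (hf.continuousAt (isOpen_Ioi.mem_nhds hy)).tendsto.comp hvy
  refine le_of_tendsto_of_tendsto hfx hfy ?_
  filter_upwards [hux.eventually (isOpen_Ioi.mem_nhds hx)] with n hn
  exact h _ _ (by exact_mod_cast hn) (by exact_mod_cast ((hu n).trans_le (hxy.trans (hv n).le)).le)

/-- The function `q log q - log (2 + q)` is convex, negative at `0` and zero at `2`. With `q = p -
2`, this equality at `2` is the source of the threshold `p = 4`. -/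
theorem rpow_self_le_add_two {q : ℝ} (h0 : 0 < q) (h2 : q ≤ 2) : q ^ q ≤ q + 2 := by
  have hconv : ConvexOn ℝ (Set.Icc (0 : ℝ) 2) fun q => q * Real.log q - Real.log (2 + q) := by
    refine (Real.convexOn_mul_log.subset (fun x hx => hx.1) (convex_Icc 0 2)).sub ?_
    refine (strictConcaveOn_log_Ioi.concaveOn.translate_right 2).subset
      (fun x hx => ?_) (convex_Icc 0 2)
    have := hx.1
    simp only [Set.mem_preimage, Set.mem_Ioi]
    linarith
  have h := hconv.le_max_of_mem_Icc (x := 0) (y := 2) (z := q) (by simp) (by simp) ⟨h0.le, h2⟩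
  have hl : 2 * Real.log 2 - Real.log (2 + 2) = 0 := by
    rw [show (2 + 2 : ℝ) = 2 ^ 2 by norm_num, Real.log_pow]; simp
  have hm : (0 : ℝ) * Real.log 0 - Real.log (2 + 0) ≤ 0 := by
    have := Real.log_nonneg (x := 2) (by norm_num)
    simp [this]
  have h := h.trans (max_le hm hl.le)
  rw [← Real.log_le_log_iff (by positivity) (by positivity), Real.log_rpow h0, add_comm q]
  exact sub_nonpos.1 h

theorem profileSlope_nonneg_of_mem_Icc {p : ℝ} (h2 : 2 ≤ p) (h4 : p ≤ 4) {x : ℝ} (hx : 0 < x) :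
    0 ≤ profileSlope p x := by
  rcases h2.eq_or_lt with rfl | h2
  · rw [profileSlope, show (2 : ℝ) - 1 = 1 by norm_num, Real.rpow_one]
    linarith
  obtain ⟨q, rfl⟩ : ∃ q, p = q + 2 := ⟨p - 2, by ring⟩
  have hq : 0 < q := by linarith
  -- Bernoulli for `(q x)^(q+1)`, the tangent line at `x = 1/q`, gives `q^q x^(q+1) ≥ (q+1) x - 1`;
  -- then `q^q ≤ q + 2` finishes.
  have bern := one_add_mul_self_le_rpow_one_add (s := q * x - 1) (p := q + 1)
    (by nlinarith) (by linarith)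
  rw [add_sub_cancel, Real.mul_rpow hq.le hx.le, Real.rpow_add_one hq.ne'] at bern
  have hpow := mul_le_mul_of_nonneg_right (rpow_self_le_add_two hq (by linarith))
    (Real.rpow_nonneg hx.le (q + 1))
  rw [profileSlope, show q + 2 - 1 = q + 1 by ring]
  nlinarith [mul_le_mul_of_nonneg_left hpow hq.le]

theorem mem_Icc_of_profileSlope_nonneg {p : ℝ} (h1 : 1 < p)
    (h : ∀ x, 0 < x → 0 ≤ profileSlope p x) : 2 ≤ p ∧ p ≤ 4 := by
  constructor
  · by_contra! hp
    -- For `p < 2` the linear term wins at large `x`. Taking `x^(2-p) = y` makes `p x^(p-1)` half of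
    -- `(p-1) x`, and `x ≥ y` makes the slope at most `1 - p`.
    set y := 2 * p / (p - 1) with hy
    have hp1 : 0 < p - 1 := by linarith
    have hyp : (p - 1) * y = 2 * p := by rw [hy]; field_simp
    have hy1 : 1 ≤ y := by rw [hy, le_div_iff₀ hp1]; linarith
    have hy0 : 0 < y := by linarith
    set x := y ^ (1 / (2 - p)) with hx
    have hx0 : 0 < x := Real.rpow_pos_of_pos hy0 _
    have hxy : y ≤ x := by
      conv_lhs => rw [← Real.rpow_one y]
      exact Real.rpow_le_rpow_of_exponent_le hy1 (by rw [le_div_iff₀] <;> linarith)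
    have hpow : x ^ (p - 1) * y = x := by
      have : x ^ (2 - p) = y := by
        rw [hx, ← Real.rpow_mul hy0.le, one_div_mul_cancel (by linarith), Real.rpow_one]
      rw [← this, ← Real.rpow_add hx0]
      ring_nf
      exact Real.rpow_one x
    have := h x hx0
    rw [profileSlope] at this
    nlinarith
  · by_contra! hp
    obtain ⟨q, rfl⟩ : ∃ q, p = q + 2 := ⟨p - 2, by ring⟩
    have hq : 2 < q := by linarith
    have hq0 : 0 < q := by linarith
    -- The point of equality in the Bernoulli bound; there the slope has the sign of `q + 2 - q^q`.
    have := h q⁻¹ (inv_pos.2 hq0)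
    rw [profileSlope, show q + 2 - 1 = q + 1 by ring, Real.inv_rpow hq0.le,
      Real.rpow_add_one hq0.ne'] at this
    have hlt : q + 2 < q ^ q := by
      calc q + 2 < q ^ (2 : ℝ) := by rw [Real.rpow_two]; nlinarith
        _ ≤ q ^ q := Real.rpow_le_rpow_of_exponent_le (by linarith) hq.le
    have hpos : 0 < q ^ q := Real.rpow_pos_of_pos hq0 _
    have e : (q + 2) * (q ^ q * q)⁻¹ + 1 - (q + 1) * q⁻¹ = (q + 2 - q ^ q) / (q ^ q * q) := by
      field_simp
      ring
    rw [e] at this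
    have := div_neg_of_neg_of_pos (sub_neg.2 hlt) (mul_pos hpos hq0)
    linarith

/-- The left side is the truncation cost when mass `t` lies outside the kept eigenvalues, in pieces
of size `(1 - t)/k`; the profile variable is the ratio of lost to kept mass. -/
theorem mul_rpow_add_eq_uniformProfile {p k t : ℝ} (hk : 0 < k) (ht : 0 ≤ t) (ht1 : t < 1) :
    k * (t / k) ^ p + t * ((1 - t) / k) ^ (p - 1) = k ^ (1 - p) * uniformProfile p (t / (1 - t)) := by
  have hs : 0 < 1 - t := by linarith
  have h1 : 1 + t / (1 - t) = (1 - t)⁻¹ := by field_simp; ring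
  have hk' : k ^ (1 - p) = k / k ^ p := by rw [Real.rpow_sub hk, Real.rpow_one]
  rw [uniformProfile, h1, Real.div_rpow ht hs.le, Real.inv_rpow hs.le, Real.div_rpow ht hk.le,
    Real.div_rpow hs.le hk.le, Real.rpow_sub_one hs.ne', Real.rpow_sub_one hk.ne', hk']
  have := Real.rpow_pos_of_pos hs p
  have := Real.rpow_pos_of_pos hk p
  field_simp

end ProfileFunction

/-! ### Lower bound for uniform spectra -/

section LowerBound

theorem exists_orthonormal_of_le_finrank {E : Type*} [NormedAddCommGroup E]
    [InnerProductSpace ℂ E] (V : Submodule ℂ E) [FiniteDimensional ℂ V] {m : ℕ}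
    (hm : m ≤ Module.finrank ℂ V) : ∃ v : Fin m → E, Orthonormal ℂ v ∧ ∀ j, v j ∈ V := by
  refine ⟨fun j => (stdOrthonormalBasis ℂ V (Fin.castLE hm j) : E), ?_, fun j => Subtype.mem _⟩
  exact ((stdOrthonormalBasis ℂ V).orthonormal.comp _ (Fin.castLE_injective hm)).comp_linearIsometry
    V.subtypeₗᵢ

variable {n k r : ℕ}

/-- Dimension count: the kernel of `Y` has dimension at least `n - k`, so it meets the
`r`-dimensional coordinate subspace, the kernel of `R`, in dimension at least `r - k`. -/
theorem exists_orthonormal_mem_ker_of_rank_le {Y : Matrix (Fin n) (Fin n) ℂ} (hY : Y.rank ≤ k)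
    (hr : r ≤ n) : ∃ v : Fin (r - k) → EuclideanSpace ℂ (Fin n), Orthonormal ℂ v ∧
      ∀ j, Matrix.toEuclideanLin Y (v j) = 0 ∧ ∀ i : Fin n, r ≤ i → v j i = 0 := by
  let R : EuclideanSpace ℂ (Fin n) →ₗ[ℂ] (Fin (n - r) → ℂ) := LinearMap.pi fun i =>
    (EuclideanSpace.proj (⟨r + i, by omega⟩ : Fin n) :
      EuclideanSpace ℂ (Fin n) →L[ℂ] ℂ).toLinearMap
  set T := Matrix.toEuclideanLin Y with hT
  have hfin : Module.finrank ℂ (EuclideanSpace ℂ (Fin n)) = n := finrank_euclideanSpace_fin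
  have h1 := R.finrank_range_add_finrank_ker
  have h2 := T.finrank_range_add_finrank_ker
  have h3 := Submodule.finrank_sup_add_finrank_inf_eq (LinearMap.ker T) (LinearMap.ker R)
  have h4 := Submodule.finrank_le (LinearMap.ker T ⊔ LinearMap.ker R)
  have h5 : Module.finrank ℂ (LinearMap.range R) ≤ n - r := by
    simpa using Submodule.finrank_le (LinearMap.range R)
  have h6 : Module.finrank ℂ (LinearMap.range T) ≤ k := by
    have := Matrix.rank_eq_finrank_range_toLin Y (PiLp.basisFun 2 ℂ (Fin n))
      (PiLp.basisFun 2 ℂ (Fin n))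
    rw [← Matrix.toLpLin_eq_toLin] at this
    exact this ▸ hY
  obtain ⟨v, hv, hmem⟩ := exists_orthonormal_of_le_finrank
    (LinearMap.ker T ⊓ LinearMap.ker R) (m := r - k) (by omega)
  refine ⟨v, hv, fun j => ⟨LinearMap.mem_ker.1 (hmem j).1, fun i hi => ?_⟩⟩
  have := congrFun (LinearMap.mem_ker.1 (hmem j).2) ⟨i - r, by omega⟩
  have hi' : (⟨r + (i - r), by omega⟩ : Fin n) = i := Fin.ext (by simp; omega)
  simpa [R, hi'] using this

/-- The density matrix of rank `r` that is uniform on the first `r` basis vectors. -/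
noncomputable def partiallyMixed (n r : ℕ) : Matrix (Fin n) (Fin n) ℂ :=
  Matrix.diagonal fun i => (((if (i : ℕ) < r then (r : ℝ)⁻¹ else 0) : ℝ) : ℂ)

theorem partiallyMixed_self (n : ℕ) : partiallyMixed n n = maximallyMixed n := by
  ext i j
  simp [partiallyMixed, maximallyMixed, Matrix.diagonal_apply, Matrix.one_apply]

theorem sum_ite_lt_inv (hr0 : 0 < r) (hr : r ≤ n) :
    ∑ i : Fin n, (if (i : ℕ) < r then (r : ℝ)⁻¹ else 0) = 1 := by
  rw [Fin.sum_univ_eq_sum_range (fun i => if i < r then (r : ℝ)⁻¹ else 0), ← Finset.sum_filter]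
  have : (Finset.range n).filter (· < r) = Finset.range r := by
    ext i; simp; omega
  rw [this, Finset.sum_const, Finset.card_range, nsmul_eq_mul,
    mul_inv_cancel₀ (by exact_mod_cast hr0.ne')]

theorem partiallyMixed_mem_densityMatrices (hr0 : 0 < r) (hr : r ≤ n) :
    partiallyMixed n r ∈ densityMatrices n := by
  constructor
  · refine Matrix.PosSemidef.diagonal fun i => ?_
    simp only [Pi.zero_apply]
    split_ifs <;> simp
  · rw [partiallyMixed, Matrix.trace_diagonal, ← Complex.ofReal_sum, sum_ite_lt_inv hr0 hr,
      Complex.ofReal_one]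

theorem toEuclideanLin_partiallyMixed_basisFun (n r : ℕ) (i : Fin n) :
    Matrix.toEuclideanLin (partiallyMixed n r) (EuclideanSpace.basisFun (Fin n) ℂ i) =
      (((if (i : ℕ) < r then (r : ℝ)⁻¹ else 0) : ℝ) : ℂ) • EuclideanSpace.basisFun (Fin n) ℂ i := by
  ext j
  rw [PiLp.smul_apply]
  by_cases h : j = i <;> simp [partiallyMixed, Matrix.mulVec_diagonal, h]

theorem toEuclideanLin_partiallyMixed_apply {v : EuclideanSpace ℂ (Fin n)}
    (hv : ∀ i : Fin n, r ≤ i → v i = 0) :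
    Matrix.toEuclideanLin (partiallyMixed n r) v = (((r : ℝ)⁻¹ : ℝ) : ℂ) • v := by
  ext j
  by_cases h : (j : ℕ) < r
  · simp [partiallyMixed, Matrix.mulVec_diagonal, h]
  · simp [partiallyMixed, Matrix.mulVec_diagonal, hv j (not_lt.1 h)]

theorem inner_partiallyMixed_sub_apply {Y : Matrix (Fin n) (Fin n) ℂ}
    {v : EuclideanSpace ℂ (Fin n)} (hv1 : ‖v‖ = 1) (hY : Matrix.toEuclideanLin Y v = 0)
    (hv : ∀ i : Fin n, r ≤ i → v i = 0) :
    (inner ℂ v (Matrix.toEuclideanLin (partiallyMixed n r - Y) v)).re = (r : ℝ)⁻¹ := by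
  rw [map_sub, LinearMap.sub_apply, hY, sub_zero, toEuclideanLin_partiallyMixed_apply hv,
    inner_smul_right, inner_self_eq_norm_sq_to_K, hv1]
  simp

theorem isHermitian_sub_of_mem_densityMatrices {X Y : Matrix (Fin n) (Fin n) ℂ}
    (hX : X ∈ densityMatrices n) (hY : Y ∈ densityMatrices n) : (X - Y).IsHermitian :=
  hX.1.isHermitian.sub hY.1.isHermitian

theorem sum_eigenvalues_eq_one {X : Matrix (Fin n) (Fin n) ℂ} (hX : X ∈ densityMatrices n)
    (hH : X.IsHermitian) : ∑ i, hH.eigenvalues i = 1 := by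
  have := hH.trace_eq_sum_eigenvalues
  rw [hX.2] at this
  refine Complex.ofReal_injective ?_
  rw [Complex.ofReal_sum, Complex.ofReal_one]
  exact this.symm

theorem inv_le_schattenNorm_top_partiallyMixed_sub (hkr : k < r) (hr : r ≤ n)
    {Y : Matrix (Fin n) (Fin n) ℂ} (hY : Y ∈ lowRankDensityMatrices n k) :
    (r : ℝ)⁻¹ ≤ schattenNorm ∞ (partiallyMixed n r - Y) := by
  obtain ⟨v, hv, hv'⟩ := exists_orthonormal_mem_ker_of_rank_le hY.2 hr
  have hH := isHermitian_sub_of_mem_densityMatrices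
    (partiallyMixed_mem_densityMatrices (by omega) hr) hY.1
  let j : Fin (r - k) := ⟨0, by omega⟩
  have := abs_re_inner_le_of_eigenbasis _ hH.eigenvectorBasis _ hH.toEuclideanLin_eigenvectorBasis
    (hv.1 j) (abs_le_schattenNorm_top _ _ _ hH.toEuclideanLin_eigenvectorBasis)
  rw [inner_partiallyMixed_sub_apply (hv.1 j) (hv' j).1 (hv' j).2] at this
  exact (le_abs_self _).trans this

/-- The kernel vectors `v` each contribute `1/r`. The eigenvectors `w` of `Y` with nonzero
eigenvalue carry all of the trace of `Y` but at most `k/r` of that of `X`, so `X - Y` has total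
discrepancy at least `(r-k)/r` on at most `k` vectors; the power mean inequality bounds its cost. -/
theorem le_sum_abs_eigenvalues_rpow {q : ℝ} (hq : 1 ≤ q) (hk : 0 < k) (hkr : k ≤ r) (hr : r ≤ n)
    {Y : Matrix (Fin n) (Fin n) ℂ} (hY : Y ∈ lowRankDensityMatrices n k)
    (hH : (partiallyMixed n r - Y).IsHermitian) :
    (k : ℝ) ^ (1 - q) * (((r - k : ℕ) : ℝ) * (r : ℝ)⁻¹) ^ q + ((r - k : ℕ) : ℝ) * ((r : ℝ)⁻¹) ^ q ≤
      ∑ i, |hH.eigenvalues i| ^ q := by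
  obtain ⟨v, hv, hv'⟩ := exists_orthonormal_mem_ker_of_rank_le hY.2 hr
  have hYh := hY.1.1.isHermitian
  set y := hYh.eigenvalues with hy
  set e := hYh.eigenvectorBasis with he
  have heY : ∀ i, Matrix.toEuclideanLin Y (e i) = (y i : ℂ) • e i :=
    hYh.toEuclideanLin_eigenvectorBasis
  have hYsymm := Matrix.isSymmetric_toEuclideanLin_iff.2 hYh
  let w : {i // y i ≠ 0} → EuclideanSpace ℂ (Fin n) := fun i => e i
  have hw : Orthonormal ℂ w := e.orthonormal.comp _ Subtype.val_injective
  have hwv : ∀ i j, inner ℂ (w i) (v j) = 0 := by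
    intro i j
    have := hYsymm (w i) (v j)
    rw [(hv' j).1, inner_zero_right, heY, inner_smul_left] at this
    simpa [i.2] using this
  have hu : Orthonormal ℂ (Sum.elim w v) := by
    rw [orthonormal_iff_ite]
    have h1 := orthonormal_iff_ite.1 hw
    have h2 := orthonormal_iff_ite.1 hv
    rintro (i | i) (j | j)
    · simpa using h1 i j
    · simpa using hwv i j
    · simpa using inner_eq_zero_symm.1 (hwv j i)
    · simpa using h2 i j
  set X := partiallyMixed n r with hX
  have hr0 : 0 < r := by omega
  have hX1 : ∑ i : Fin n, |if (i : ℕ) < r then (r : ℝ)⁻¹ else 0| ^ (1 : ℝ) = 1 := by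
    refine (Finset.sum_congr rfl fun i _ => ?_).trans (sum_ite_lt_inv hr0 hr)
    rw [Real.rpow_one, abs_of_nonneg]
    split_ifs <;> positivity
  -- With exponent `1`, the inequality says that the diagonal of `X` along `w` and `v` sums to at
  -- most its trace.
  have htr := sum_abs_re_inner_rpow_le _ _ _ (toEuclideanLin_partiallyMixed_basisFun n r) hu
    le_rfl
  rw [hX1, Fintype.sum_sum_type, ← hX] at htr
  simp only [Sum.elim_inl, Sum.elim_inr, Real.rpow_one] at htr
  have hXv : ∀ j, (inner ℂ (v j) (Matrix.toEuclideanLin X (v j))).re = (r : ℝ)⁻¹ := by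
    intro j
    have := inner_partiallyMixed_sub_apply (hv.1 j) (hv' j).1 (hv' j).2
    rwa [map_sub, LinearMap.sub_apply, (hv' j).1, sub_zero] at this
  have hXYv : ∀ j, (inner ℂ (v j) (Matrix.toEuclideanLin (X - Y) (v j))).re = (r : ℝ)⁻¹ :=
    fun j => inner_partiallyMixed_sub_apply (hv.1 j) (hv' j).1 (hv' j).2
  have hpei := sum_abs_re_inner_rpow_le _ _ _ hH.toEuclideanLin_eigenvectorBasis hu hq
  rw [Fintype.sum_sum_type] at hpei
  simp only [Sum.elim_inl, Sum.elim_inr] at hpei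
  simp only [hXv, hXYv, Finset.sum_const, Finset.card_univ, Fintype.card_fin, nsmul_eq_mul,
    abs_of_nonneg (inv_nonneg.2 (Nat.cast_nonneg (α := ℝ) r))] at htr hpei
  refine le_trans (add_le_add_left ?_ _) hpei
  set z : {i // y i ≠ 0} → ℝ := fun i =>
    (inner ℂ (w i) (Matrix.toEuclideanLin (X - Y) (w i))).re with hz
  have hzi : ∀ i : {i // y i ≠ 0}, y i - |(inner ℂ (w i) (Matrix.toEuclideanLin X (w i))).re| ≤ |z i| := by
    intro i
    have : z i = (inner ℂ (w i) (Matrix.toEuclideanLin X (w i))).re - y i := by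
      rw [hz]
      simp only
      rw [map_sub, LinearMap.sub_apply, inner_sub_right, heY, inner_smul_right,
        inner_self_eq_norm_sq_to_K, hw.1 i]
      simp
    rw [this, abs_sub_comm]
    exact le_trans (sub_le_sub_left (le_abs_self _) _) (le_abs_self _)
  have hysum : ∑ i : {i // y i ≠ 0}, y i = 1 := by
    have h1 : ∑ i, y i = 1 := sum_eigenvalues_eq_one hY.1 hYh
    rw [← h1, ← Finset.sum_subtype (Finset.univ.filter fun i => y i ≠ 0) (by simp) y,
      Finset.sum_filter_ne_zero]
  have hzsum : ((r - k : ℕ) : ℝ) * (r : ℝ)⁻¹ ≤ ∑ i, |z i| := by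
    refine le_trans ?_ (Finset.sum_le_sum fun i _ => hzi i)
    rw [Finset.sum_sub_distrib, hysum]
    linarith
  have hcard : (Fintype.card {i // y i ≠ 0} : ℝ) ≤ k := by
    rw [hy, ← hYh.rank_eq_card_non_zero_eigs]
    exact_mod_cast hY.2
  have hk' : (0 : ℝ) < k := by exact_mod_cast hk
  have hjen := Real.rpow_sum_le_const_mul_sum_rpow Finset.univ z hq
  rw [Finset.card_univ] at hjen
  have hS : 0 ≤ ∑ i, |z i| ^ q := Finset.sum_nonneg fun i _ => by positivity
  calc (k : ℝ) ^ (1 - q) * (((r - k : ℕ) : ℝ) * (r : ℝ)⁻¹) ^ q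
      ≤ (k : ℝ) ^ (1 - q) * ((k : ℝ) ^ (q - 1) * ∑ i, |z i| ^ q) := by
        refine mul_le_mul_of_nonneg_left ?_ (by positivity)
        refine (Real.rpow_le_rpow (by positivity) hzsum (by linarith)).trans (hjen.trans ?_)
        exact mul_le_mul_of_nonneg_right
          (Real.rpow_le_rpow (by positivity) hcard (by linarith)) hS
    _ = ∑ i, |z i| ^ q := by
        rw [← mul_assoc, ← Real.rpow_add hk']
        simp

theorem uniformProfile_le_schattenNorm_partiallyMixed_sub {p : ℝ≥0∞} (hp : 1 ≤ p) (hp' : p ≠ ∞)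
    (hk : 0 < k) (hkr : k ≤ r) (hr : r ≤ n)
    {Y : Matrix (Fin n) (Fin n) ℂ} (hY : Y ∈ lowRankDensityMatrices n k) :
    ((k : ℝ) ^ (1 - p.toReal) * uniformProfile p.toReal (((r : ℝ) - k) / k)) ^ (1 / p.toReal) ≤
      schattenNorm p (partiallyMixed n r - Y) := by
  have hq : 1 ≤ p.toReal := by
    rw [← ENNReal.toReal_one]
    exact ENNReal.toReal_mono hp' hp
  have hH := isHermitian_sub_of_mem_densityMatrices
    (partiallyMixed_mem_densityMatrices (by omega) hr) hY.1
  rw [schattenNorm_of_eigenbasis hp' _ _ _ hH.toEuclideanLin_eigenvectorBasis]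
  have hk' : (0 : ℝ) < k := by exact_mod_cast hk
  have hkr' : (k : ℝ) ≤ r := by exact_mod_cast hkr
  have hr' : (0 : ℝ) < r := by linarith
  refine Real.rpow_le_rpow (mul_nonneg (by positivity) (uniformProfile_nonneg _
    (div_nonneg (by linarith) hk'.le))) ?_ (by positivity)
  -- The bound is the truncation cost with `t = (r-k)/r`, for which `(1 - t)/k = 1/r`.
  refine le_trans (le_of_eq ?_) (le_sum_abs_eigenvalues_rpow hq hk hkr hr hY hH)
  have h1 : 1 - ((r : ℝ) - k) * (r : ℝ)⁻¹ = k / r := by field_simp; ring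
  have h2 : ((r : ℝ) - k) / k = ((r : ℝ) - k) * (r : ℝ)⁻¹ / (1 - ((r : ℝ) - k) * (r : ℝ)⁻¹) := by
    rw [h1]; field_simp
  have ht : 0 ≤ ((r : ℝ) - k) * (r : ℝ)⁻¹ := mul_nonneg (by linarith) (by positivity)
  rw [h2, ← mul_rpow_add_eq_uniformProfile hk' ht (by have := div_pos hk' hr'; linarith), h1,
    Nat.cast_sub hkr]
  congr 1
  · rw [Real.div_rpow ht hk'.le, Real.rpow_sub hk', Real.rpow_one]
    ring
  · rw [show (k : ℝ) / r / k = (r : ℝ)⁻¹ by field_simp, mul_assoc, mul_comm (r : ℝ)⁻¹,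
      ← Real.rpow_add_one (by positivity), sub_add_cancel]

end LowerBound

/-! ### Upper bound by spectral truncation -/

section UpperBound

variable {n k : ℕ}

/-- `Y` keeps the eigenvalues indexed by `S`, each raised by an equal share of the discarded mass to
restore trace one. -/
theorem exists_mem_lowRankDensityMatrices_eigenbasis {X : Matrix (Fin n) (Fin n) ℂ}
    (hX : X ∈ densityMatrices n) (hH : X.IsHermitian) {S : Finset (Fin n)} (hS : S.card = k)
    (hk : 0 < k) :
    ∃ Y ∈ lowRankDensityMatrices n k, ∀ i, Matrix.toEuclideanLin (X - Y) (hH.eigenvectorBasis i) =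
      (((if i ∈ S then -((∑ j ∈ Sᶜ, hH.eigenvalues j) / k) else hH.eigenvalues i) : ℝ) : ℂ) •
        hH.eigenvectorBasis i := by
  set t := ∑ j ∈ Sᶜ, hH.eigenvalues j with ht
  have hnn := (hH.posSemidef_iff_eigenvalues_nonneg.1 hX.1)
  have ht0 : 0 ≤ t := Finset.sum_nonneg fun i _ => hnn i
  have hk' : (0 : ℝ) < k := by exact_mod_cast hk
  let d : Fin n → ℝ := fun i => if i ∈ S then hH.eigenvalues i + t / k else 0
  have hsum := sum_eigenvalues_eq_one hX hH
  refine ⟨hH.withEigenvalues d, ⟨⟨hH.posSemidef_withEigenvalues fun i => ?_, ?_⟩, ?_⟩, fun i => ?_⟩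
  · simp only [d]
    split_ifs
    · exact add_nonneg (hnn i) (by positivity)
    · exact le_rfl
  · have : ∑ i, d i = 1 := by
      simp only [d]
      rw [Finset.sum_ite_mem, Finset.univ_inter, Finset.sum_add_distrib, Finset.sum_const, hS,
        nsmul_eq_mul, mul_div_cancel₀ _ hk'.ne', ht, Finset.sum_add_sum_compl, hsum]
    rw [hH.trace_withEigenvalues, this, Complex.ofReal_one]
  · rw [← hS]
    exact hH.rank_withEigenvalues_le fun i hi => if_neg hi
  · rw [map_sub, LinearMap.sub_apply, hH.toEuclideanLin_eigenvectorBasis,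
      hH.toEuclideanLin_withEigenvalues, ← sub_smul, ← Complex.ofReal_sub]
    congr 2
    simp only [d]
    split_ifs <;> ring

theorem schattenDist_le_of_card_eq {p : ℝ≥0∞} (hp' : p ≠ ∞) {X : Matrix (Fin n) (Fin n) ℂ}
    (hX : X ∈ densityMatrices n) (hH : X.IsHermitian) {S : Finset (Fin n)} (hS : S.card = k)
    (hk : 0 < k) :
    schattenDist p X (lowRankDensityMatrices n k) ≤
      ((k : ℝ) * ((∑ j ∈ Sᶜ, hH.eigenvalues j) / k) ^ p.toReal +
        ∑ j ∈ Sᶜ, hH.eigenvalues j ^ p.toReal) ^ (1 / p.toReal) := by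
  obtain ⟨Y, hY, hb⟩ := exists_mem_lowRankDensityMatrices_eigenbasis hX hH hS hk
  have hnn := (hH.posSemidef_iff_eigenvalues_nonneg.1 hX.1)
  refine (schattenDist_le_schattenNorm p X hY).trans (le_of_eq ?_)
  rw [schattenNorm_of_eigenbasis hp' _ _ _ hb, ← Finset.sum_add_sum_compl S]
  congr 2
  · rw [Finset.sum_congr rfl fun i hi => by rw [if_pos hi], Finset.sum_const, hS, nsmul_eq_mul,
      abs_neg, abs_of_nonneg]
    exact div_nonneg (Finset.sum_nonneg fun i _ => hnn i) (Nat.cast_nonneg k)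
  · refine Finset.sum_congr rfl fun i hi => ?_
    rw [if_neg (Finset.mem_compl.1 hi), abs_of_nonneg (hnn i)]

theorem exists_card_eq_forall_le (f : Fin n → ℝ) (hkn : k ≤ n) :
    ∃ S : Finset (Fin n), S.card = k ∧ ∀ i ∈ S, ∀ j ∈ Sᶜ, f j ≤ f i := by
  induction k with
  | zero => exact ⟨∅, by simp⟩
  | succ k ih =>
    obtain ⟨S, hS, h⟩ := ih (by omega)
    have hne : (Sᶜ).Nonempty := by
      rw [← Finset.card_pos, Finset.card_compl, Fintype.card_fin]
      omega
    obtain ⟨a, ha, hmax⟩ := Finset.exists_max_image Sᶜ f hne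
    refine ⟨insert a S, by rw [Finset.card_insert_of_notMem (Finset.mem_compl.1 ha), hS], ?_⟩
    intro i hi j hj
    have hj' : j ∈ Sᶜ := by
      simp only [Finset.mem_compl, Finset.mem_insert, not_or] at hj ⊢
      exact hj.2
    rcases Finset.mem_insert.1 hi with rfl | hi
    · exact hmax j hj'
    · exact h i hi j hj'

theorem schattenDist_le_of_monotoneOn {p : ℝ≥0∞} (hp : 1 ≤ p) (hp' : p ≠ ∞) (hk : 0 < k)
    (hkn : k ≤ n) (hmono : MonotoneOn (uniformProfile p.toReal) (Set.Ici 0))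
    {X : Matrix (Fin n) (Fin n) ℂ} (hX : X ∈ densityMatrices n) :
    schattenDist p X (lowRankDensityMatrices n k) ≤
      ((k : ℝ) ^ (1 - p.toReal) * uniformProfile p.toReal (((n : ℝ) - k) / k)) ^
        (1 / p.toReal) := by
  have hq : 1 ≤ p.toReal := by
    rw [← ENNReal.toReal_one]
    exact ENNReal.toReal_mono hp' hp
  set q := p.toReal with hqdef
  have hH := hX.1.isHermitian
  have hnn := (hH.posSemidef_iff_eigenvalues_nonneg.1 hX.1)
  have hsum := sum_eigenvalues_eq_one hX hH
  obtain ⟨S, hS, hle⟩ := exists_card_eq_forall_le hH.eigenvalues hkn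
  have hk' : (0 : ℝ) < k := by exact_mod_cast hk
  have hkn' : (k : ℝ) ≤ n := by exact_mod_cast hkn
  refine (schattenDist_le_of_card_eq hp' hX hH hS hk).trans ?_
  rw [← hqdef]
  set t := ∑ j ∈ Sᶜ, hH.eigenvalues j with ht
  have ht0 : 0 ≤ t := Finset.sum_nonneg fun i _ => hnn i
  have hSt : ∑ j ∈ S, hH.eigenvalues j = 1 - t := by
    rw [← hsum, ← Finset.sum_add_sum_compl S]; ring
  -- A discarded eigenvalue is at most every kept one, hence at most their mean.
  have hbound : ∀ j ∈ Sᶜ, hH.eigenvalues j ≤ (1 - t) / k := by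
    intro j hj
    rw [le_div_iff₀ hk', ← hSt, mul_comm, ← nsmul_eq_mul, ← hS]
    exact Finset.card_nsmul_le_sum _ _ _ fun i hi => hle i hi j hj
  have hcardc : ((Sᶜ).card : ℝ) = n - k := by
    rw [Finset.card_compl, Fintype.card_fin, hS, Nat.cast_sub hkn]
  have htle : t ≤ (n - k) * ((1 - t) / k) := by
    rw [← hcardc, ← nsmul_eq_mul]
    exact Finset.sum_le_card_nsmul _ _ _ hbound
  have htn : t * k ≤ (n - k) * (1 - t) := by
    rwa [mul_div_assoc', le_div_iff₀ hk'] at htle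
  have ht1 : t < 1 := by
    by_contra! h
    nlinarith
  have hs : 0 < 1 - t := by linarith
  refine Real.rpow_le_rpow (add_nonneg (by positivity)
    (Finset.sum_nonneg fun i _ => Real.rpow_nonneg (hnn i) _)) ?_ (by positivity)
  calc _ ≤ (k : ℝ) * (t / k) ^ q + t * ((1 - t) / k) ^ (q - 1) := by
        refine add_le_add_right ?_ _
        rw [ht, Finset.sum_mul, ← ht]
        refine Finset.sum_le_sum fun j hj => ?_
        rcases (hnn j).eq_or_lt with h0 | h0
        · simp only [Pi.zero_apply] at h0
          rw [← h0, Real.zero_rpow (by linarith), zero_mul]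
        · simp only [Pi.zero_apply] at h0
          calc _ = hH.eigenvalues j * hH.eigenvalues j ^ (q - 1) := by
                rw [mul_comm, ← Real.rpow_add_one h0.ne', sub_add_cancel]
            _ ≤ _ := mul_le_mul_of_nonneg_left
                (Real.rpow_le_rpow h0.le (hbound j hj) (by linarith)) h0.le
    _ = (k : ℝ) ^ (1 - q) * uniformProfile q (t / (1 - t)) :=
        mul_rpow_add_eq_uniformProfile hk' ht0 ht1
    _ ≤ _ := by
        refine mul_le_mul_of_nonneg_left (hmono ?_ ?_ ?_) (by positivity)
        · exact div_nonneg ht0 hs.le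
        · exact div_nonneg (by linarith) hk'.le
        · rwa [div_le_div_iff₀ hs hk']

theorem eigenvalues_maximallyMixed (hH : (maximallyMixed n).IsHermitian) (i : Fin n) :
    hH.eigenvalues i = (n : ℝ)⁻¹ := by
  have h1 := hH.toEuclideanLin_eigenvectorBasis i
  have h2 : Matrix.toEuclideanLin (maximallyMixed n) (hH.eigenvectorBasis i) =
      (((n : ℝ)⁻¹ : ℝ) : ℂ) • hH.eigenvectorBasis i := by
    have := toEuclideanLin_partiallyMixed_apply (r := n) (v := hH.eigenvectorBasis i)
      fun i hi => absurd hi (by omega)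
    rwa [partiallyMixed_self] at this
  rw [h2] at h1
  have := smul_left_injective ℂ (hH.eigenvectorBasis.orthonormal.ne_zero i) h1
  exact_mod_cast this.symm

/-- Here no monotonicity is needed: the eigenvalues are all equal, so any `S` of size `k` attains
the profile value exactly. This is what the converse direction requires. -/
theorem schattenDist_maximallyMixed_le {p : ℝ≥0∞} (hp' : p ≠ ∞) (hk : 0 < k)
    (hkn : k ≤ n) :
    schattenDist p (maximallyMixed n) (lowRankDensityMatrices n k) ≤
      ((k : ℝ) ^ (1 - p.toReal) * uniformProfile p.toReal (((n : ℝ) - k) / k)) ^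
        (1 / p.toReal) := by
  have hX : maximallyMixed n ∈ densityMatrices n :=
    partiallyMixed_self n ▸ partiallyMixed_mem_densityMatrices (by omega) le_rfl
  have hH := hX.1.isHermitian
  obtain ⟨S, -, hS⟩ := Finset.exists_subset_card_eq
    (show k ≤ (Finset.univ : Finset (Fin n)).card by simpa using hkn)
  refine (schattenDist_le_of_card_eq hp' hX hH hS hk).trans (le_of_eq ?_)
  have hk' : (0 : ℝ) < k := by exact_mod_cast hk
  have hkn' : (k : ℝ) ≤ n := by exact_mod_cast hkn
  have hn' : (0 : ℝ) < n := by linarith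
  have hcardc : ((Sᶜ).card : ℝ) = n - k := by
    rw [Finset.card_compl, Fintype.card_fin, hS, Nat.cast_sub hkn]
  simp only [eigenvalues_maximallyMixed, Finset.sum_const, nsmul_eq_mul, hcardc]
  have h1 : 1 - ((n : ℝ) - k) * (n : ℝ)⁻¹ = k / n := by field_simp; ring
  have h2 : ((n : ℝ) - k) / k = ((n : ℝ) - k) * (n : ℝ)⁻¹ / (1 - ((n : ℝ) - k) * (n : ℝ)⁻¹) := by
    rw [h1]; field_simp
  have ht : 0 ≤ ((n : ℝ) - k) * (n : ℝ)⁻¹ := mul_nonneg (by linarith) (by positivity)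
  rw [h2, ← mul_rpow_add_eq_uniformProfile hk' ht (by have := div_pos hk' hn'; linarith), h1]
  congr 2
  rw [show (k : ℝ) / n / k = (n : ℝ)⁻¹ by field_simp, mul_assoc, mul_comm (n : ℝ)⁻¹,
      ← Real.rpow_add_one (by positivity), sub_add_cancel]

theorem lowRankDensityMatrices_nonempty (hk : 0 < k) (hkn : k ≤ n) :
    (lowRankDensityMatrices n k).Nonempty := by
  have hX : maximallyMixed n ∈ densityMatrices n :=
    partiallyMixed_self n ▸ partiallyMixed_mem_densityMatrices (by omega) le_rfl
  obtain ⟨S, -, hS⟩ := Finset.exists_subset_card_eq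
    (show k ≤ (Finset.univ : Finset (Fin n)).card by simpa using hkn)
  obtain ⟨Y, hY, -⟩ :=
    exists_mem_lowRankDensityMatrices_eigenbasis hX hX.1.isHermitian hS hk
  exact ⟨Y, hY⟩

theorem le_schattenDist_partiallyMixed {p : ℝ≥0∞} (hp : 1 ≤ p) (hp' : p ≠ ∞) {r : ℕ}
    (hk : 0 < k) (hkr : k ≤ r) (hr : r ≤ n) :
    ((k : ℝ) ^ (1 - p.toReal) * uniformProfile p.toReal (((r : ℝ) - k) / k)) ^ (1 / p.toReal) ≤
      schattenDist p (partiallyMixed n r) (lowRankDensityMatrices n k) := by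
  refine le_csInf ((lowRankDensityMatrices_nonempty hk (hkr.trans hr)).image _) ?_
  rintro _ ⟨Y, hY, rfl⟩
  exact uniformProfile_le_schattenNorm_partiallyMixed_sub hp hp' hk hkr hr hY

end UpperBound

/-! ### The equivalence -/

section Characterization

theorem monotoneOn_uniformProfile_of_schattenDist_le {p : ℝ≥0∞} (hp : 1 ≤ p) (hp' : p ≠ ∞)
    (h : ∀ n k : ℕ, 1 ≤ k → k ≤ n → ∀ X ∈ densityMatrices n,
      schattenDist p X (lowRankDensityMatrices n k) ≤
        schattenDist p (maximallyMixed n) (lowRankDensityMatrices n k)) :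
    MonotoneOn (uniformProfile p.toReal) (Set.Ioi 0) := by
  have hq : 1 ≤ p.toReal := by
    rw [← ENNReal.toReal_one]
    exact ENNReal.toReal_mono hp' hp
  have key : ∀ k m₁ m₂ : ℕ, 0 < k → m₁ ≤ m₂ →
      uniformProfile p.toReal (m₁ / k) ≤ uniformProfile p.toReal (m₂ / k) := by
    intro k m₁ m₂ hk hm
    have hk' : (0 : ℝ) < k := by exact_mod_cast hk
    -- A uniform spectrum of length `k + m₁` inside dimension `k + m₂` compares the profile at
    -- `m₁/k` and `m₂/k`.
    have h1 := (le_schattenDist_partiallyMixed hp hp' (n := k + m₂) (r := k + m₁) hk (by omega)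
      (by omega)).trans ((h (k + m₂) k hk (by omega) _
        (partiallyMixed_mem_densityMatrices (by omega) (by omega))).trans
          (schattenDist_maximallyMixed_le hp' hk (by omega)))
    simp only [Nat.cast_add, add_sub_cancel_left] at h1
    have hnn : ∀ m : ℕ, 0 ≤ (k : ℝ) ^ (1 - p.toReal) * uniformProfile p.toReal (m / k) :=
      fun m => mul_nonneg (by positivity) (uniformProfile_nonneg _ (by positivity))
    rw [Real.rpow_le_rpow_iff (hnn _) (hnn _) (by positivity)] at h1
    exact le_of_mul_le_mul_left h1 (by positivity)
  refine monotoneOn_of_rat ((continuousOn_uniformProfile hq).mono Set.Ioi_subset_Ici_self) ?_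
  intro a b ha hab
  have hb : 0 < b := ha.trans_le hab
  lift a to ℚ≥0 using ha.le
  lift b to ℚ≥0 using hb.le
  have hab : a ≤ b := by exact_mod_cast hab
  have hfrac : ∀ (c : ℚ≥0) (l : ℕ), 0 < l →
      (((c : ℚ) : ℝ)) = ((c.num * l : ℕ) : ℝ) / ((c.den * l : ℕ) : ℝ) := by
    intro c l hl
    have : (l : ℝ) ≠ 0 := by exact_mod_cast hl.ne'
    have hd : (c.den : ℝ) ≠ 0 := by exact_mod_cast c.den_pos.ne'
    have hc : ((c : ℚ) : ℝ) = (c.num : ℝ) / c.den := by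
      conv_lhs => rw [← NNRat.num_div_den c]
      push_cast
      rfl
    rw [hc]
    push_cast
    field_simp
  -- The common denominator plays the role of `k`.
  rw [hfrac a b.den b.den_pos, hfrac b a.den a.den_pos, mul_comm b.den a.den]
  refine key _ _ _ (Nat.mul_pos a.den_pos b.den_pos) ?_
  exact NNRat.le_def.1 hab

/-- Take `n = 4`, `k = 2`: the spectrum uniform on three values is at distance at least `1/3`,
whereas truncating `I/4` costs only `1/4`. -/
theorem not_forall_schattenDist_top_le : ¬ ∀ n k : ℕ, 1 ≤ k → k ≤ n → ∀ X ∈ densityMatrices n,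
      schattenDist ∞ X (lowRankDensityMatrices n k) ≤
        schattenDist ∞ (maximallyMixed n) (lowRankDensityMatrices n k) := by
  intro h
  have h1 := h 4 2 (by norm_num) (by norm_num) (partiallyMixed 4 3)
    (partiallyMixed_mem_densityMatrices (by norm_num) (by norm_num))
  have h2 : ((3 : ℕ) : ℝ)⁻¹ ≤
      schattenDist ∞ (partiallyMixed 4 3) (lowRankDensityMatrices 4 2) := by
    refine le_csInf ((lowRankDensityMatrices_nonempty (by norm_num) (by norm_num)).image _) ?_
    rintro _ ⟨Y, hY, rfl⟩
    exact inv_le_schattenNorm_top_partiallyMixed_sub (by norm_num) (by norm_num) hY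
  have hX : maximallyMixed 4 ∈ densityMatrices 4 :=
    partiallyMixed_self 4 ▸ partiallyMixed_mem_densityMatrices (by norm_num) le_rfl
  have hH := hX.1.isHermitian
  obtain ⟨Y, hY, hb⟩ := exists_mem_lowRankDensityMatrices_eigenbasis hX hH
    (S := ({0, 1} : Finset (Fin 4))) (k := 2) (by decide) (by norm_num)
  have h3 : schattenDist ∞ (maximallyMixed 4) (lowRankDensityMatrices 4 2) ≤ 1 / 4 := by
    refine (schattenDist_le_schattenNorm ∞ _ hY).trans (schattenNorm_top_le _ _ _ hb fun i => ?_)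
    have hc : (({0, 1} : Finset (Fin 4))ᶜ).card = 2 := by decide
    simp only [eigenvalues_maximallyMixed, Finset.sum_const, hc]
    split_ifs <;> norm_num [abs_of_nonneg, abs_neg]
  norm_num at h2
  linarith

end Characterization

theorem theorem7 (p : ℝ≥0∞) (hp : 1 ≤ p) :
    (∀ n k : ℕ, 1 ≤ k → k ≤ n → ∀ X ∈ densityMatrices n,
      schattenDist p X (lowRankDensityMatrices n k) ≤
        schattenDist p (maximallyMixed n) (lowRankDensityMatrices n k)) ↔
    p ∈ ({1} ∪ Set.Icc 2 4 : Set ℝ≥0∞) := by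
  rcases eq_or_ne p ∞ with rfl | hp'
  · refine iff_of_false not_forall_schattenDist_top_le ?_
    simp
  obtain ⟨q, hq, rfl⟩ : ∃ q : ℝ, 1 ≤ q ∧ ENNReal.ofReal q = p := by
    refine ⟨p.toReal, ?_, ENNReal.ofReal_toReal hp'⟩
    rw [← ENNReal.toReal_one]
    exact ENNReal.toReal_mono hp' hp
  have hq0 : 0 ≤ q := by linarith
  have hmem : ENNReal.ofReal q ∈ ({1} ∪ Set.Icc 2 4 : Set ℝ≥0∞) ↔ q = 1 ∨ 2 ≤ q ∧ q ≤ 4 := by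
    rw [Set.mem_union, Set.mem_singleton_iff, ENNReal.ofReal_eq_one, Set.mem_Icc,
      ← ENNReal.ofReal_ofNat 2, ← ENNReal.ofReal_ofNat 4, ENNReal.ofReal_le_ofReal_iff hq0,
      ENNReal.ofReal_le_ofReal_iff (by norm_num)]
  rw [hmem]
  constructor
  · intro h
    have hmono := monotoneOn_uniformProfile_of_schattenDist_le hp hp' h
    rw [ENNReal.toReal_ofReal hq0] at hmono
    rcases hq.eq_or_lt with h1 | h1
    · exact Or.inl h1.symm
    · exact Or.inr (mem_Icc_of_profileSlope_nonneg h1 fun x hx =>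
        profileSlope_nonneg_of_monotoneOn hmono hx)
  · intro h n k hk hkn X hX
    have hmono : MonotoneOn (uniformProfile (ENNReal.ofReal q).toReal) (Set.Ici 0) := by
      rw [ENNReal.toReal_ofReal hq0]
      refine monotoneOn_uniformProfile hq fun x hx => ?_
      rcases h with rfl | ⟨h2, h4⟩
      · simp [profileSlope]
      · exact profileSlope_nonneg_of_mem_Icc h2 h4 hx
    rw [← partiallyMixed_self]
    exact (schattenDist_le_of_monotoneOn hp hp' hk hkn hmono hX).trans
      (le_schattenDist_partiallyMixed hp hp' hk hkn le_rfl)
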